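/- Let $0<a<b$. Consider the Dirichlet–Neumann waveform relaxation (DNWR) algorithm with relaxation parameter $\theta=1/2$ for the error equations (zero source, zero initial data, zero outer boundary data) of the one-dimensional heat equation $\partial_t u=\partial_{xx}u$ on $(-a,b)$, split into the Dirichlet subdomain $(-a,0)$ and the Neumann subdomain $(0,b)$. Write $\hat f(s)=\int_0^\infty e^{-st}f(t)\,dt$ for the Laplace transform in time. Starting from an initial interface error $h^0:(0,\infty)\to\mathbb R$, for $k=1,2,3,\dots$ the algorithm determines $u_1^k(x,t)$ on $[-a,0]$, $u_2^k(x,t)$ on $[0,b]$ and the new interface error $h^k(t)$ through $$(s-\partial_{xx})\hat u_1^k=0\ \text{ on }(-a,0),\qquad \hat u_1^k(-a,s)=0,\qquad \hat u_1^k(0,s)=\hat h^{k-1}(s),$$ $$(s-\partial_{xx})\hat u_2^k=0\ \text{ on }(0,b),\qquad \partial_x\hat u_2^k(0,s)=\partial_x\hat u_1^k(0,s),\qquad \hat u_2^k(b,s)=0,$$ $$\hat h^k(s)=\tfrac12\,\hat u_2^k(0,s)+\tfrac12\,\hat h^{k-1}(s),$$ for all complex $s$ in a half plane $\operatorname{Re}s>\sigma$,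 where it is assumed that the Laplace transforms of all the $h^k$, $u_1^k(x,\cdot)$ and $u_2^k(x,\cdot)$ converge absolutely for $\operatorname{Re}s\ge\sigma$. Then for all $k=0,1,2,\dots$ $$\|h^{2k}\|_{L^\infty(0,\infty)}\le\left(\frac{b-a}{2a}\right)^{2k}\|h^0\|_{L^\infty(0,\infty)},$$ and for every $T>0$ and all $k=0,1,2,\dots$ $$\|h^{2k}\|_{L^\infty(0,T)}\le\left(\frac{\sqrt2}{1-e^{-(2k+1)a^2/T}}\right)^{2k}e^{-k^2a^2/T}\,\|h^0\|_{L^\infty(0,T)},$$ where the norms may take the value $+\infty$. -/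

import Mathlib

open MeasureTheory Set

open scoped ENNReal

noncomputable section

namespace DNWR

/-- The one-sided Laplace transform `∫₀^∞ e^{-st} f(t) dt` of a real function of time. -/
def laplace (f : ℝ → ℝ) (s : ℂ) : ℂ :=
  ∫ t in Ioi (0 : ℝ), Complex.exp (-s * (t : ℂ)) * (f t : ℂ)

/-- The Laplace transform of `f` converges absolutely on the half plane `σ ≤ Re s`
(in particular `f` is a.e. measurable on `(0,∞)`). -/
def HasLaplace (σ : ℝ) (f : ℝ → ℝ) : Prop :=
  IntegrableOn (fun t : ℝ => Real.exp (-σ * t) * f t) (Ioi 0)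

/-- `U` solves `(s - ∂ₓₓ) U = 0` on `(p, q)` and is continuous up to the end points. -/
structure SolvesODE (s : ℂ) (p q : ℝ) (U : ℝ → ℂ) : Prop where
  continuousOn : ContinuousOn U (Icc p q)
  contDiffOn : ContDiffOn ℝ 2 U (Ioo p q)
  ode : ∀ x ∈ Ioo p q, s * U x - iteratedDeriv 2 U x = 0

/-- The Dirichlet step on `(-a, 0)` at the complex frequency `s`, with interface value `g`. -/
structure DirichletStep (a : ℝ) (s g : ℂ) (U : ℝ → ℂ) : Prop where
  solves : SolvesODE s (-a) 0 U
  left : U (-a) = 0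
  interface : U 0 = g

/-- The Neumann step on `(0, b)` at the complex frequency `s`: at the interface `x = 0` the
(one-sided) spatial derivative equals that of the Dirichlet solution `U₁` on `(-a, 0)`. -/
structure NeumannStep (a b : ℝ) (s : ℂ) (U₁ U₂ : ℝ → ℂ) : Prop where
  solves : SolvesODE s 0 b U₂
  flux : ∃ d : ℂ, HasDerivWithinAt U₁ d (Icc (-a) 0) 0 ∧ HasDerivWithinAt U₂ d (Icc 0 b) 0
  right : U₂ b = 0

/-- `h 0, h 1, …` are the interface values (functions of time) and `u₁ k x t`, `u₂ k x t`
(`k ≥ 1`) the subdomain solutions produced by the Dirichlet-Neumann waveform relaxation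
algorithm with relaxation parameter `θ`, applied to the error equations (zero source, initial
and outer boundary data) of the heat equation on `(-a, b)`, with Dirichlet subdomain `(-a, 0)`
and Neumann subdomain `(0, b)`, in Laplace transformed form; all the transforms are taken on
the half plane `σ < Re s`. -/
structure IsIteration (a b θ σ : ℝ) (h : ℕ → ℝ → ℝ) (u₁ u₂ : ℕ → ℝ → ℝ → ℝ) : Prop where
  laplace_h : ∀ k, HasLaplace σ (h k)
  laplace_u₁ : ∀ k, ∀ x ∈ Icc (-a) 0, HasLaplace σ (u₁ (k + 1) x)
  laplace_u₂ : ∀ k, ∀ x ∈ Icc 0 b, HasLaplace σ (u₂ (k + 1) x)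
  dirichlet : ∀ k (s : ℂ), σ < s.re →
    DirichletStep a s (laplace (h k) s) (fun x => laplace (u₁ (k + 1) x) s)
  neumann : ∀ k (s : ℂ), σ < s.re →
    NeumannStep a b s (fun x => laplace (u₁ (k + 1) x) s) (fun x => laplace (u₂ (k + 1) x) s)
  update : ∀ k (s : ℂ), σ < s.re →
    laplace (h (k + 1)) s = (θ : ℂ) * laplace (u₂ (k + 1) 0) s + (1 - (θ : ℂ)) * laplace (h k) s

end DNWR

end

/-!
At a real frequency `s = z²` both subdomain problems are solved by combinations of `e^{±zx}`
(`SolvesODE.exists_eq_exp`), so that one sweep with `θ = 1/2` multiplies the transform of the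
interface error by `-symbol a b z`, where
`symbol a b z = sinh((b - a)z) / (2 sinh(az) cosh(bz))` (`IsIteration.laplace_succ`).

The main point is positivity: `symbol a b (√s)` is `(b - a) / (2a)` times the Laplace transform of a
probability measure `ρ` on `[0, ∞)` (`exists_measure_symbol`). Euler's products write the normalised
symbol as an infinite product of factors `(1 + q s) / (1 + p s)` with `0 ≤ q ≤ p`. Here `a < b` is
used: the zeros `-(nπ/(b - a))²` of `sinh((b - a)√s)` lie beyond the poles `-((n - 1/2)π/b)²` coming
from `cosh(b√s)`. Each factor is the transform of a mixture of a point mass at `0` and an exponential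
law, and `ρ` is the law of the almost surely convergent sum of independent variables with these laws
(`IsProbLaplace.tendsto_prod`).

By uniqueness of the Laplace transform (`HasLaplace.ae_eq_zero`), `h (k + 1)` is then
`-(b - a) / (2a)` times the causal convolution of `h k` with `ρ`. Hence a bound
`|h k t| ≤ M e^{s₀t}` on `(0, T)` passes to `h (k + 1)` with `M` multiplied by
`(b - a) / (2a) ∫ e^{-s₀x} ∂ρ` (`HasLaplace.ae_bound`). With `s₀ = 0` this is the linear bound.
With `s₀ = z²`, `z = (k + 1/2) a / T`, it gives after `2k` sweeps the factor
`symbol(z)^{2k} e^{z²T}`, a Chernoff bound. As `symbol(z) ≤ e^{-2az} / (1 - e^{-2az})` and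
`2az = (2k + 1)a²/T`, this factor is below the superlinear bound, with room to spare.
-/

namespace DNWR

open Filter Topology ProbabilityTheory

/-! ### The subdomain problems in the frequency domain -/

/-- Solutions of `U'' = w² U` are combinations of `e^{wx}` and `e^{-wx}`, up to the end points. -/
lemma SolvesODE.exists_eq_exp {w : ℂ} (hw : w ≠ 0) {p q : ℝ} (hpq : p < q) {U : ℝ → ℂ}
    (hU : SolvesODE (w ^ 2) p q U) :
    ∃ A B : ℂ, ∀ x ∈ Icc p q, U x = A * Complex.exp (w * x) + B * Complex.exp (-(w * x)) := by
  have hd1 : ∀ x ∈ Ioo p q, HasDerivAt U (deriv U x) x := fun x hx =>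
    ((hU.contDiffOn.differentiableOn (by norm_num)).differentiableAt
      (isOpen_Ioo.mem_nhds hx)).hasDerivAt
  have hC1 : ContDiffOn ℝ 1 (deriv U) (Ioo p q) :=
    hU.contDiffOn.deriv_of_isOpen isOpen_Ioo (by norm_num)
  have hd2 : ∀ x ∈ Ioo p q, HasDerivAt (deriv U) (w ^ 2 * U x) x := by
    intro x hx
    have h := ((hC1.differentiableOn (by norm_num)).differentiableAt
      (isOpen_Ioo.mem_nhds hx)).hasDerivAt
    have h2 := hU.ode x hx
    rw [iteratedDeriv_succ, iteratedDeriv_one, sub_eq_zero] at h2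
    rwa [← h2] at h
  have hexp : ∀ (v : ℂ) (x : ℝ),
      HasDerivAt (fun x : ℝ => Complex.exp (v * x)) (v * Complex.exp (v * x)) x := by
    intro v x
    have h := ((hasDerivAt_id x).ofReal_comp.const_mul v).cexp
    simpa [mul_comm] using h
  -- The factors `U' - vU`, for `v = ±w`, satisfy first order equations.
  have hfirst : ∀ v : ℂ, v ^ 2 = w ^ 2 → ∃ c : ℂ, ∀ x ∈ Ioo p q,
      deriv U x - v * U x = c * Complex.exp (-(v * x)) := by
    intro v hv
    have hder : ∀ x ∈ Ioo p q, HasDerivAt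
        (fun x : ℝ => (deriv U x - v * U x) * Complex.exp (v * x)) 0 x := by
      intro x hx
      refine (((hd2 x hx).sub ((hd1 x hx).const_mul v)).mul (hexp v x)).congr_deriv ?_
      simp only [Pi.sub_apply]
      linear_combination (-(U x) * Complex.exp (v * x)) * hv
    obtain ⟨c, hc⟩ := isOpen_Ioo.exists_is_const_of_deriv_eq_zero
      (isPreconnected_Ioo (a := p) (b := q))
      (fun x hx => (hder x hx).differentiableAt.differentiableWithinAt)
      (fun x hx => (hder x hx).deriv)
    refine ⟨c, fun x hx => ?_⟩
    rw [← hc x hx, mul_assoc, ← Complex.exp_add]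
    simp
  obtain ⟨c, hc⟩ := hfirst w rfl
  obtain ⟨c', hc'⟩ := hfirst (-w) (by ring)
  refine ⟨c' / (2 * w), -c / (2 * w), ?_⟩
  have hIoo : EqOn U (fun x : ℝ => c' / (2 * w) * Complex.exp (w * x)
      + -c / (2 * w) * Complex.exp (-(w * x))) (Ioo p q) := by
    intro x hx
    have h1 := hc x hx
    have h2 := hc' x hx
    rw [neg_mul, neg_mul, neg_neg] at h2
    simp only
    field_simp
    linear_combination h2 - h1
  exact hIoo.of_subset_closure hU.continuousOn (by fun_prop) Ioo_subset_Icc_self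
    (closure_Ioo hpq.ne).symm.subset

/-- The Dirichlet-to-Neumann-to-Dirichlet map of one sweep, at the frequency `s = w²`. -/
lemma NeumannStep.interface_eq {a b : ℝ} (ha : 0 < a) (hb : 0 < b) {w g : ℂ} (hw : w ≠ 0)
    {U₁ U₂ : ℝ → ℂ} (h₁ : DirichletStep a (w ^ 2) g U₁) (h₂ : NeumannStep a b (w ^ 2) U₁ U₂) :
    Complex.sinh (w * a) * Complex.cosh (w * b) * U₂ 0 =
      -(g * Complex.cosh (w * a) * Complex.sinh (w * b)) := by
  have key : ∀ (A B d : ℂ) (U : ℝ → ℂ) (p q : ℝ), p < q → (0 : ℝ) ∈ Icc p q →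
      (∀ x ∈ Icc p q, U x = A * Complex.exp (w * x) + B * Complex.exp (-(w * x))) →
      HasDerivWithinAt U d (Icc p q) 0 → d = w * (A - B) := by
    intro A B d U p q hpq h0 hU hd
    have hid : HasDerivAt (fun x : ℝ => w * (x : ℂ)) w 0 := by
      simpa using (hasDerivAt_id (0 : ℝ)).ofReal_comp.const_mul w
    have h := ((hid.cexp.const_mul A).add (hid.neg.cexp.const_mul B)).hasDerivWithinAt
      (s := Icc p q)
    have h' := h.congr hU (hU 0 h0)
    rw [(uniqueDiffOn_Icc hpq 0 h0).eq_deriv _ hd h']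
    simp
    ring
  obtain ⟨A, B, hAB⟩ := h₁.solves.exists_eq_exp hw (by linarith)
  obtain ⟨C, D, hCD⟩ := h₂.solves.exists_eq_exp hw hb
  obtain ⟨d, hd₁, hd₂⟩ := h₂.flux
  have e1 := key A B d U₁ (-a) 0 (by linarith) ⟨by linarith, le_rfl⟩ hAB hd₁
  have e2 := key C D d U₂ 0 b hb ⟨le_rfl, hb.le⟩ hCD hd₂
  have e3 : A - B = C - D := mul_left_cancel₀ hw (e1.symm.trans e2)
  have l1 := hAB (-a) ⟨le_rfl, by linarith⟩
  have l2 := hAB 0 ⟨by linarith, le_rfl⟩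
  have r1 := hCD b ⟨hb.le, le_rfl⟩
  have r2 := hCD 0 ⟨le_rfl, hb.le⟩
  rw [h₁.left] at l1
  rw [h₁.interface] at l2
  rw [h₂.right] at r1
  simp only [Complex.ofReal_neg, Complex.ofReal_zero, mul_zero, neg_zero, Complex.exp_zero,
    mul_one, mul_neg, neg_neg] at l1 l2 r1 r2
  rw [r2, l2, Complex.sinh, Complex.cosh, Complex.sinh, Complex.cosh]
  set E := Complex.exp (w * a)
  set E' := Complex.exp (-(w * a))
  set F := Complex.exp (w * b)
  set F' := Complex.exp (-(w * b))
  linear_combination (-(E - E') / 2) * r1 + (-(F - F') / 2) * l1 + (E - E') * (F - F') / 4 * e3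

/-- The symbol of one iteration: `ĥ^{k+1} = -symbol(√s) ĥ^k` for `θ = 1/2`. -/
noncomputable def symbol (a b z : ℝ) : ℝ :=
  Real.sinh (z * (b - a)) / (2 * Real.sinh (z * a) * Real.cosh (z * b))

lemma laplace_ofReal (f : ℝ → ℝ) (s : ℝ) :
    laplace f s = ((∫ t in Ioi (0 : ℝ), Real.exp (-s * t) * f t : ℝ) : ℂ) := by
  rw [laplace, ← integral_complex_ofReal]
  simp

lemma IsIteration.laplace_succ {a b σ : ℝ} (ha : 0 < a) (hb : 0 < b) {h : ℕ → ℝ → ℝ}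
    {u₁ u₂ : ℕ → ℝ → ℝ → ℝ} (hiter : IsIteration a b (1 / 2) σ h u₁ u₂) (k : ℕ) {z : ℝ}
    (hz : 0 < z) (hσ : σ < z ^ 2) :
    ∫ t in Ioi (0 : ℝ), Real.exp (-z ^ 2 * t) * h (k + 1) t =
      -symbol a b z * ∫ t in Ioi (0 : ℝ), Real.exp (-z ^ 2 * t) * h k t := by
  have hs : σ < ((z : ℂ) ^ 2).re := by rw [← Complex.ofReal_pow, Complex.ofReal_re]; exact hσ
  have hw : (z : ℂ) ≠ 0 := by exact_mod_cast hz.ne'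
  have h1 := NeumannStep.interface_eq ha hb hw (hiter.dirichlet k _ hs) (hiter.neumann k _ hs)
  have h2 := hiter.update k _ hs
  rw [← Complex.ofReal_pow] at h1 h2
  rw [laplace_ofReal, laplace_ofReal, laplace_ofReal] at h2
  simp only [laplace_ofReal] at h1
  norm_cast at h1
  have h2' : ∫ t in Ioi (0 : ℝ), Real.exp (-z ^ 2 * t) * h (k + 1) t =
      1 / 2 * (∫ t in Ioi (0 : ℝ), Real.exp (-z ^ 2 * t) * u₂ (k + 1) 0 t) +
      (1 - 1 / 2) * ∫ t in Ioi (0 : ℝ), Real.exp (-z ^ 2 * t) * h k t := by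
    apply Complex.ofReal_injective
    push_cast at h2 ⊢
    exact h2
  have hS : 0 < Real.sinh (z * a) := Real.sinh_pos_iff.2 (by positivity)
  have hC : 0 < Real.cosh (z * b) := Real.cosh_pos _
  rw [h2', symbol, mul_sub, Real.sinh_sub]
  generalize (∫ t in Ioi (0 : ℝ), Real.exp (-z ^ 2 * t) * u₂ (k + 1) 0 t) = U at h1 ⊢
  generalize (∫ t in Ioi (0 : ℝ), Real.exp (-z ^ 2 * t) * h k t) = H at h1 ⊢
  field_simp
  linear_combination h1

/-! ### Laplace transforms of probability measures on the half-line -/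

/-- `Φ` is, on `[0, ∞)`, the Laplace transform of a probability measure carried by `[0, ∞)` whose
mean is at most `m`. -/
def IsProbLaplace (m : ℝ≥0∞) (Φ : ℝ → ℝ) : Prop :=
  ∃ ρ : Measure ℝ, IsProbabilityMeasure ρ ∧ (∀ᵐ x ∂ρ, 0 ≤ x) ∧
    ∫⁻ x, ENNReal.ofReal x ∂ρ ≤ m ∧ ∀ s, 0 ≤ s → ∫ x, Real.exp (-s * x) ∂ρ = Φ s

lemma integrable_exp_neg_mul {ρ : Measure ℝ} [IsFiniteMeasure ρ] (hρ : ∀ᵐ x ∂ρ, 0 ≤ x) {s : ℝ}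
    (hs : 0 ≤ s) : Integrable (fun x => Real.exp (-s * x)) ρ := by
  refine Integrable.of_bound (C := 1) (by fun_prop) ?_
  filter_upwards [hρ] with x hx
  rw [Real.norm_eq_abs, Real.abs_exp, Real.exp_le_one_iff]
  nlinarith

lemma IsProbLaplace.mul {m m' : ℝ≥0∞} {Φ Φ' : ℝ → ℝ} (h : IsProbLaplace m Φ)
    (h' : IsProbLaplace m' Φ') : IsProbLaplace (m + m') (fun s => Φ s * Φ' s) := by
  obtain ⟨ρ, hp, h0, hm, hL⟩ := h
  obtain ⟨ρ', hp', h0', hm', hL'⟩ := h'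
  have h00 : ∀ᵐ x : ℝ × ℝ ∂ρ.prod ρ', 0 ≤ x.1 ∧ 0 ≤ x.2 := by
    filter_upwards [Measure.quasiMeasurePreserving_fst.ae h0,
      Measure.quasiMeasurePreserving_snd.ae h0'] with x hx hx' using ⟨hx, hx'⟩
  have hmeas : Measurable fun x : ℝ × ℝ => x.1 + x.2 := by fun_prop
  refine ⟨(ρ.prod ρ').map fun x => x.1 + x.2, Measure.isProbabilityMeasure_map hmeas.aemeasurable,
    ?_, ?_, fun s hs => ?_⟩
  · rw [ae_map_iff hmeas.aemeasurable measurableSet_Ici]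
    filter_upwards [h00] with x hx using add_nonneg hx.1 hx.2
  · rw [lintegral_map (by fun_prop) hmeas]
    calc ∫⁻ x : ℝ × ℝ, ENNReal.ofReal (x.1 + x.2) ∂ρ.prod ρ'
        ≤ ∫⁻ x : ℝ × ℝ, (ENNReal.ofReal x.1 + ENNReal.ofReal x.2) ∂ρ.prod ρ' :=
          lintegral_mono fun x => ENNReal.ofReal_add_le
      _ = (∫⁻ x, ENNReal.ofReal x ∂ρ) + ∫⁻ x, ENNReal.ofReal x ∂ρ' := by
          rw [lintegral_add_left (by fun_prop),
            ← measurePreserving_fst.lintegral_comp (μ := ρ.prod ρ') (ν := ρ)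
              ENNReal.measurable_ofReal,
            ← measurePreserving_snd.lintegral_comp (μ := ρ.prod ρ') (ν := ρ')
              ENNReal.measurable_ofReal]
      _ ≤ m + m' := add_le_add hm hm'
  · beta_reduce
    rw [integral_map hmeas.aemeasurable (by fun_prop), ← hL s hs, ← hL' s hs,
      ← integral_prod_mul]
    simp only [mul_add, Real.exp_add]

/-- A sum of independent random variables with summable means converges almost surely. -/
lemma IsProbLaplace.tendsto_prod {m : ℕ → ℝ≥0∞} {Φ : ℕ → ℝ → ℝ} {Ψ : ℝ → ℝ}
    (h : ∀ n, IsProbLaplace (m n) (Φ n)) (hm : ∑' n, m n ≠ ∞)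
    (hΨ : ∀ s, 0 ≤ s → Tendsto (fun n => ∏ i ∈ Finset.range n, Φ i s) atTop (𝓝 (Ψ s))) :
    IsProbLaplace (∑' n, m n) Ψ := by
  choose ρ hp h0 hmean hL using h
  set P := Measure.infinitePi ρ
  have hpres : ∀ n, MeasurePreserving (Function.eval n) P (ρ n) :=
    fun n => measurePreserving_eval_infinitePi ρ n
  have hind : iIndepFun (fun n (ω : ℕ → ℝ) => ω n) P := iIndepFun_infinitePi fun _ => measurable_id
  set Y : (ℕ → ℝ) → ℝ≥0∞ := fun ω => ∑' n, ENNReal.ofReal (ω n)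
  have hY : Measurable Y := Measurable.tsum fun n =>
    ENNReal.measurable_ofReal.comp (measurable_pi_apply n)
  have hYint : ∫⁻ ω, Y ω ∂P ≤ ∑' n, m n := by
    rw [lintegral_tsum (f := fun n (ω : ℕ → ℝ) => ENNReal.ofReal (ω n)) fun n =>
      (ENNReal.measurable_ofReal.comp (measurable_pi_apply n)).aemeasurable]
    refine ENNReal.tsum_le_tsum fun n => ?_
    exact ((hpres n).lintegral_comp ENNReal.measurable_ofReal).trans_le (hmean n)
  have hYfin : ∀ᵐ ω ∂P, Y ω < ∞ := ae_lt_top hY (hYint.trans_lt hm.lt_top).ne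
  have hnn : ∀ᵐ ω ∂P, ∀ n, 0 ≤ ω n := ae_all_iff.2 fun n => (hpres n).quasiMeasurePreserving.ae (h0 n)
  have hX : Measurable fun ω => (Y ω).toReal := hY.ennreal_toReal
  refine ⟨P.map fun ω => (Y ω).toReal, Measure.isProbabilityMeasure_map hX.aemeasurable, ?_, ?_,
    fun s hs => ?_⟩
  · rw [ae_map_iff hX.aemeasurable measurableSet_Ici]
    exact ae_of_all _ fun ω => ENNReal.toReal_nonneg
  · rw [lintegral_map ENNReal.measurable_ofReal hX]
    exact (lintegral_mono fun ω => ENNReal.ofReal_toReal_le).trans hYint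
  · rw [integral_map hX.aemeasurable (by fun_prop)]
    refine tendsto_nhds_unique (f := fun n => ∫ ω, ∏ i ∈ Finset.range n, Real.exp (-s * ω i) ∂P)
      (l := atTop) ?_ ?_
    · refine tendsto_integral_of_dominated_convergence (fun _ => 1) (fun n => ?_)
        (integrable_const 1) (fun n => ?_) ?_
      · exact (Finset.measurable_prod _ fun i _ => by fun_prop).aestronglyMeasurable
      · filter_upwards [hnn] with ω hω
        rw [Real.norm_eq_abs, Finset.abs_prod]
        refine Finset.prod_le_one (fun _ _ => abs_nonneg _) fun i _ => ?_
        rw [Real.abs_exp, Real.exp_le_one_iff]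
        nlinarith [hω i]
      · filter_upwards [hnn, hYfin] with ω hω hfin
        have hsum : Tendsto (fun n => ∑ i ∈ Finset.range n, ω i) atTop (𝓝 (Y ω).toReal) := by
          have h1 := (ENNReal.tendsto_toReal hfin.ne).comp
            (ENNReal.summable.hasSum (f := fun n => ENNReal.ofReal (ω n))).tendsto_sum_nat
          refine h1.congr fun n => ?_
          simp only [Function.comp_apply]
          rw [ENNReal.toReal_sum fun _ _ => ENNReal.ofReal_ne_top]
          exact Finset.sum_congr rfl fun i _ => ENNReal.toReal_ofReal (hω i)
        refine ((Real.continuous_exp.tendsto _).comp (hsum.const_mul (-s))).congr fun n => ?_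
        simp only [Function.comp_apply, Finset.mul_sum, Real.exp_sum]
    · refine (hΨ s hs).congr fun n => ?_
      have hn := (hind.precomp (g := fun i : Finset.range n => (i : ℕ))
        Subtype.val_injective).integral_fun_prod_comp (f := fun _ x => Real.exp (-s * x))
        (fun i => (measurable_pi_apply _).aemeasurable) (fun i => by fun_prop)
      rw [Finset.prod_coe_sort (Finset.range n) (fun i => ∫ ω, Real.exp (-s * ω i) ∂P)] at hn
      have hl : ∀ ω : ℕ → ℝ, ∏ i : Finset.range n, Real.exp (-s * ω i) =
          ∏ i ∈ Finset.range n, Real.exp (-s * ω i) := fun ω =>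
        Finset.prod_coe_sort (Finset.range n) (fun i => Real.exp (-s * ω i))
      simp only [hl] at hn
      rw [hn]
      refine Finset.prod_congr rfl fun i _ => ?_
      rw [← hL i s hs, ← (hpres i).map_eq,
        integral_map (hpres i).measurable.aemeasurable (by fun_prop)]

lemma isProbLaplace_exponential {p : ℝ} (hp : 0 < p) :
    IsProbLaplace (ENNReal.ofReal p) (fun s => 1 / (1 + p * s)) := by
  have hr : 0 < p⁻¹ := inv_pos.2 hp
  have hint : ∀ c : ℝ, 0 < c → ∫ x in Ioi (0 : ℝ), Real.exp (-c * x) = 1 / c := fun c hc => by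
    rw [integral_exp_mul_Ioi (by linarith)]; simp
  set ρ : Measure ℝ := (volume.restrict (Ioi 0)).withDensity
    fun x => ENNReal.ofReal (p⁻¹ * Real.exp (-p⁻¹ * x))
  have hmeas : Measurable fun x : ℝ => ENNReal.ofReal (p⁻¹ * Real.exp (-p⁻¹ * x)) := by fun_prop
  have hgi : ∀ c : ℝ, 0 < c → IntegrableOn (fun x => Real.exp (-c * x)) (Ioi 0) := fun c hc =>
    integrableOn_exp_mul_Ioi (by linarith) 0
  refine ⟨ρ, ⟨?_⟩, ?_, ?_, fun s hs => ?_⟩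
  · rw [withDensity_apply _ MeasurableSet.univ, Measure.restrict_univ,
      ← ofReal_integral_eq_lintegral_ofReal ((hgi _ hr).const_mul _)
        (ae_of_all _ fun x => by positivity), integral_const_mul, hint _ hr]
    field_simp
    simp
  · refine (withDensity_absolutelyContinuous _ _).ae_le ?_
    filter_upwards [self_mem_ae_restrict measurableSet_Ioi] with x hx using le_of_lt hx
  · rw [lintegral_withDensity_eq_lintegral_mul _ hmeas ENNReal.measurable_ofReal]
    have hG := Real.integral_rpow_mul_exp_neg_mul_Ioi (a := 2) (r := p⁻¹) (by norm_num) hr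
    have hGi : IntegrableOn (fun x : ℝ => x ^ ((2 : ℝ) - 1) * Real.exp (-(p⁻¹ * x))) (Ioi 0) := by
      by_contra hcon
      rw [integral_undef hcon] at hG
      have : (0 : ℝ) < (1 / p⁻¹) ^ (2 : ℝ) * Real.Gamma 2 := by
        have := Real.Gamma_pos_of_pos (s := 2) (by norm_num)
        positivity
      linarith
    have heq : ∀ x ∈ Ioi (0 : ℝ), (fun x => ENNReal.ofReal (p⁻¹ * Real.exp (-p⁻¹ * x))
        * ENNReal.ofReal x) x =
        ENNReal.ofReal (p⁻¹ * (x ^ ((2 : ℝ) - 1) * Real.exp (-(p⁻¹ * x)))) := by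
      intro x hx
      simp only
      rw [← ENNReal.ofReal_mul (by positivity)]
      norm_num
      ring_nf
    simp only [Pi.mul_apply]
    rw [setLIntegral_congr_fun measurableSet_Ioi heq,
      ← ofReal_integral_eq_lintegral_ofReal (hGi.const_mul _), integral_const_mul, hG]
    · refine ENNReal.ofReal_le_ofReal (le_of_eq ?_)
      rw [Real.Gamma_two]
      norm_num
      field_simp
    · filter_upwards [self_mem_ae_restrict measurableSet_Ioi] with x hx
      have : (0 : ℝ) < x := hx
      simp only [Pi.zero_apply]
      positivity
  · rw [integral_withDensity_eq_integral_toReal_smul hmeas (by simp)]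
    have : ∀ x : ℝ, (ENNReal.ofReal (p⁻¹ * Real.exp (-p⁻¹ * x))).toReal • Real.exp (-s * x) =
        p⁻¹ * Real.exp (-(p⁻¹ + s) * x) := by
      intro x
      rw [ENNReal.toReal_ofReal (by positivity), smul_eq_mul, mul_assoc, ← Real.exp_add]
      ring_nf
    simp only [this]
    rw [integral_const_mul, hint _ (by positivity)]
    field_simp

/-- The symbol `(1 + q s) / (1 + p s)` with `q ≤ p` belongs to a mixture of a point mass at `0`
and an exponential law. -/
lemma isProbLaplace_linear_div {p q : ℝ} (hp : 0 < p) (hq : 0 ≤ q) (hqp : q ≤ p) :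
    IsProbLaplace (ENNReal.ofReal p) (fun s => (1 + q * s) / (1 + p * s)) := by
  obtain ⟨ρ, hprob, h0, hm, hL⟩ := isProbLaplace_exponential hp
  have hqp1 : q / p ≤ 1 := (div_le_one hp).2 hqp
  have hq0 : 0 ≤ q / p := by positivity
  set u : ℝ≥0∞ := ENNReal.ofReal (q / p)
  set v : ℝ≥0∞ := ENNReal.ofReal (1 - q / p)
  have huv : u + v = 1 := by
    rw [← ENNReal.ofReal_add hq0 (by linarith)]; simp
  refine ⟨u • Measure.dirac 0 + v • ρ, ⟨by simp [huv]⟩, ?_, ?_, fun s hs => ?_⟩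
  · rw [ae_add_measure_iff]
    refine ⟨Measure.ae_smul_measure ?_ _, Measure.ae_smul_measure h0 _⟩
    rw [ae_dirac_iff measurableSet_Ici]
  · rw [lintegral_add_measure, lintegral_smul_measure, lintegral_smul_measure, lintegral_dirac]
    simp only [ENNReal.ofReal_zero, smul_eq_mul, mul_zero, zero_add]
    calc v * _ ≤ 1 * ENNReal.ofReal p := mul_le_mul' (huv ▸ le_add_self) hm
      _ = _ := one_mul _
  · have hi := integrable_exp_neg_mul h0 hs
    rw [integral_add_measure ((integrable_dirac (by simp)).smul_measure ENNReal.ofReal_ne_top)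
      (hi.smul_measure ENNReal.ofReal_ne_top), integral_smul_measure, integral_smul_measure,
      integral_dirac, hL s hs, ENNReal.toReal_ofReal hq0, ENNReal.toReal_ofReal (by linarith)]
    have : 0 < 1 + p * s := by positivity
    simp
    field_simp
    ring

/-! ### Euler products and positivity of the symbol -/

lemma tendsto_euler_sinh_prod (x : ℝ) :
    Tendsto (fun n : ℕ => x * ∏ j ∈ Finset.range n, (1 + x ^ 2 / (Real.pi * (j + 1)) ^ 2))
      atTop (𝓝 (Real.sinh x)) := by
  have h := (Complex.tendsto_euler_sin_prod (x * Complex.I / Real.pi)).mul_const (-Complex.I)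
  have hpi : (Real.pi : ℂ) ≠ 0 := by exact_mod_cast Real.pi_ne_zero
  rw [mul_div_cancel₀ _ hpi, Complex.sin_mul_I] at h
  rw [mul_assoc, mul_neg, Complex.I_mul_I, neg_neg, mul_one] at h
  have h2 := (Complex.continuous_re.tendsto _).comp h
  rw [← Complex.ofReal_sinh, Complex.ofReal_re] at h2
  refine h2.congr fun n => ?_
  have e : ∀ j : ℕ, (1 - ((x : ℂ) * Complex.I / Real.pi) ^ 2 / ((j : ℂ) + 1) ^ 2) =
      ((1 + x ^ 2 / (Real.pi * (j + 1)) ^ 2 : ℝ) : ℂ) := by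
    intro j
    push_cast
    rw [div_pow, mul_pow, Complex.I_sq, mul_pow, div_div]
    ring
  simp only [Function.comp_apply, e]
  rw [← Complex.ofReal_prod]
  have : (x : ℂ) * Complex.I *
      ((∏ j ∈ Finset.range n, (1 + x ^ 2 / (Real.pi * (j + 1)) ^ 2) : ℝ) : ℂ) * -Complex.I =
      ((x * ∏ j ∈ Finset.range n, (1 + x ^ 2 / (Real.pi * (j + 1)) ^ 2) : ℝ) : ℂ) := by
    push_cast
    linear_combination (-(x : ℂ) * ∏ j ∈ Finset.range n, (1 + (x : ℂ) ^ 2 / (Real.pi * (j + 1)) ^ 2))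
      * Complex.I_sq
  rw [this, Complex.ofReal_re]

/-- The product for `cosh`, from `cosh x = sinh (2x) / (2 sinh x)`: the even factors of `sinh (2x)`
are those of `sinh x`. -/
lemma tendsto_euler_cosh_prod (x : ℝ) :
    Tendsto (fun n : ℕ => ∏ j ∈ Finset.range n, (1 + x ^ 2 / (Real.pi * (j + 1 / 2)) ^ 2))
      atTop (𝓝 (Real.cosh x)) := by
  rcases eq_or_ne x 0 with rfl | hx
  · simp
  have h1 := tendsto_euler_sinh_prod x
  have h2 := (tendsto_euler_sinh_prod (2 * x)).comp (tendsto_id.const_mul_atTop' two_pos)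
  have hs : Real.sinh x ≠ 0 := Real.sinh_ne_zero.2 hx
  have h3 := (h2.div h1 hs).div_const 2
  rw [Real.sinh_two_mul] at h3
  have e : 2 * Real.sinh x * Real.cosh x / Real.sinh x / 2 = Real.cosh x := by field_simp
  rw [e] at h3
  refine h3.congr fun n => ?_
  have hsplit : ∀ n : ℕ, ∏ j ∈ Finset.range (2 * n), (1 + (2 * x) ^ 2 / (Real.pi * (j + 1)) ^ 2) =
      (∏ j ∈ Finset.range n, (1 + x ^ 2 / (Real.pi * (j + 1 / 2)) ^ 2)) *
        ∏ j ∈ Finset.range n, (1 + x ^ 2 / (Real.pi * (j + 1)) ^ 2) := by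
    intro n
    induction n with
    | zero => simp
    | succ n ih =>
      rw [mul_add, mul_one, Finset.prod_range_succ, Finset.prod_range_succ, ih,
        Finset.prod_range_succ, Finset.prod_range_succ]
      have e1 : (2 * x) ^ 2 / (Real.pi * (((2 * n : ℕ) : ℝ) + 1)) ^ 2 =
          x ^ 2 / (Real.pi * (n + 1 / 2)) ^ 2 := by
        push_cast; field_simp
      have e2 : (2 * x) ^ 2 / (Real.pi * (((2 * n + 1 : ℕ) : ℝ) + 1)) ^ 2 =
          x ^ 2 / (Real.pi * (n + 1)) ^ 2 := by
        push_cast; field_simp; ring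
      rw [e1, e2]
      ring
  have hpos : ∏ j ∈ Finset.range n, (1 + x ^ 2 / (Real.pi * ((j : ℝ) + 1)) ^ 2) ≠ 0 :=
    (Finset.prod_pos fun j _ => by positivity).ne'
  simp only [Pi.div_apply, Function.comp_apply, id_eq, hsplit]
  field_simp

/-- Each zero of `sinh(β√s) / cosh(b√s)`, `β = b - a`, is paired with a pole closer to the
origin, and `1 / sinh(a√s)` has no zeros: up to its value `(b - a) / (2a)` at `s = 0`, the symbol
is therefore the Laplace transform of a probability measure. -/
lemma exists_measure_symbol {a b : ℝ} (ha : 0 < a) (hab : a < b) :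
    ∃ ρ : Measure ℝ, IsProbabilityMeasure ρ ∧ (∀ᵐ x ∂ρ, 0 ≤ x) ∧
      ∀ z, 0 < z → (b - a) / (2 * a) * ∫ x, Real.exp (-z ^ 2 * x) ∂ρ = symbol a b z := by
  have hb : 0 < b := ha.trans hab
  have hβ : 0 < b - a := sub_pos.2 hab
  have hsumm : ∀ c d : ℝ, 1 / 2 ≤ d →
      ∑' n : ℕ, ENNReal.ofReal (c ^ 2 / (Real.pi * (n + d)) ^ 2) ≠ ∞ := by
    intro c d hd
    refine Summable.tsum_ofReal_ne_top ?_
    refine (((Real.summable_one_div_nat_add_rpow d 2).2 (by norm_num)).mul_left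
      (c ^ 2 / Real.pi ^ 2)).congr fun n => ?_
    rw [abs_of_nonneg (by positivity), Real.rpow_two]
    field_simp
  obtain ⟨m₁, h1⟩ : ∃ m, IsProbLaplace m fun s => if s = 0 then 1 else
      Real.sinh (Real.sqrt s * (b - a)) / (Real.sqrt s * (b - a)) / Real.cosh (Real.sqrt s * b) := by
    refine ⟨_, IsProbLaplace.tendsto_prod (Φ := fun n s =>
      (1 + (b - a) ^ 2 / (Real.pi * (n + 1)) ^ 2 * s) / (1 + b ^ 2 / (Real.pi * (n + 1 / 2)) ^ 2 * s))
      (fun n => isProbLaplace_linear_div (p := b ^ 2 / (Real.pi * (n + 1 / 2)) ^ 2) (by positivity)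
        (by positivity) ?_) (hsumm b (1 / 2) le_rfl) fun s hs => ?_⟩
    · gcongr <;> linarith
    · rcases eq_or_ne s 0 with rfl | hs0
      · simp
      have hz : 0 < Real.sqrt s := Real.sqrt_pos.2 (hs.lt_of_ne' hs0)
      rw [if_neg hs0]
      refine (((tendsto_euler_sinh_prod (Real.sqrt s * (b - a))).div_const _).div
        (tendsto_euler_cosh_prod (Real.sqrt s * b)) (Real.cosh_pos _).ne').congr fun n => ?_
      rw [Pi.div_apply, Finset.prod_div_distrib, mul_div_cancel_left₀ _ (by positivity)]
      simp only [mul_pow, Real.sq_sqrt hs, mul_div_assoc, mul_comm s, div_mul_eq_mul_div]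
  obtain ⟨m₂, h2⟩ : ∃ m, IsProbLaplace m fun s => if s = 0 then 1 else
      Real.sqrt s * a / Real.sinh (Real.sqrt s * a) := by
    refine ⟨_, IsProbLaplace.tendsto_prod (Φ := fun n s =>
      1 / (1 + a ^ 2 / (Real.pi * (n + 1)) ^ 2 * s))
      (fun n => isProbLaplace_exponential (p := a ^ 2 / (Real.pi * (n + 1)) ^ 2) (by positivity))
      (hsumm a 1 (by norm_num)) fun s hs => ?_⟩
    rcases eq_or_ne s 0 with rfl | hs0
    · simp
    have hz : 0 < Real.sqrt s := Real.sqrt_pos.2 (hs.lt_of_ne' hs0)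
    rw [if_neg hs0]
    have hne : Real.sinh (Real.sqrt s * a) ≠ 0 := Real.sinh_ne_zero.2 (by positivity)
    refine ((tendsto_const_nhds (x := Real.sqrt s * a)).div
      (tendsto_euler_sinh_prod (Real.sqrt s * a)) hne).congr fun n => ?_
    rw [Pi.div_apply, Finset.prod_div_distrib, Finset.prod_const_one,
      div_mul_cancel_left₀ (by positivity), ← one_div]
    simp only [mul_pow, Real.sq_sqrt hs, mul_div_assoc, mul_comm s, div_mul_eq_mul_div]
  obtain ⟨ρ, hρ, h0, -, hL⟩ := h1.mul h2
  refine ⟨ρ, hρ, h0, fun z hz => ?_⟩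
  rw [hL _ (sq_nonneg z)]
  have hne : 0 < Real.sinh (z * a) := Real.sinh_pos_iff.2 (by positivity)
  have hc := Real.cosh_pos (z * b)
  simp only [pow_eq_zero_iff two_ne_zero, hz.ne', if_false, Real.sqrt_sq hz.le, symbol]
  field_simp

/-! ### Uniqueness of the Laplace transform -/

/-- The moment generating function on `(-∞, δ)`, `δ > 0`, determines a finite measure: the
identity theorem carries the equality over to the imaginary axis. -/
lemma measure_ext_of_mgf_eq {μ ν : Measure ℝ} [IsFiniteMeasure μ] [IsFiniteMeasure ν]
    {δ : ℝ} (hδ : 0 < δ) (hμ : ∀ t < δ, Integrable (fun x => Real.exp (t * x)) μ)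
    (hν : ∀ t < δ, Integrable (fun x => Real.exp (t * x)) ν)
    (h : ∀ t < δ, ∫ x, Real.exp (t * x) ∂μ = ∫ x, Real.exp (t * x) ∂ν) : μ = ν := by
  have hstrip : ∀ κ : Measure ℝ, (∀ t < δ, Integrable (fun x => Real.exp (t * x)) κ) →
      AnalyticOnNhd ℂ (complexMGF id κ) {z | z.re < δ} := by
    intro κ hκ z hz
    refine analyticAt_complexMGF ?_
    exact mem_interior_iff_mem_nhds.2 (mem_of_superset (isOpen_Iio.mem_nhds hz) fun t ht => hκ t ht)
  have hpre : IsPreconnected {z : ℂ | z.re < δ} := (convex_halfSpace_re_lt δ).isPreconnected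
  have heq : EqOn (complexMGF id μ) (complexMGF id ν) {z | z.re < δ} := by
    refine (hstrip μ hμ).eqOn_of_preconnected_of_frequently_eq (hstrip ν hν) hpre
      (z₀ := ((0 : ℝ) : ℂ)) (by simpa using hδ) ?_
    have hreal : ∃ᶠ x : ℝ in 𝓝[≠] 0, complexMGF id μ x = complexMGF id ν x := by
      refine Eventually.frequently ?_
      filter_upwards [mem_nhdsWithin_of_mem_nhds (isOpen_Iio.mem_nhds hδ)] with x hx
      rw [complexMGF_ofReal, complexMGF_ofReal]
      exact congrArg _ (h x hx)
    have htend : Tendsto (fun x : ℝ => (x : ℂ)) (𝓝[≠] 0) (𝓝[≠] ((0 : ℝ) : ℂ)) := by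
      refine tendsto_nhdsWithin_iff.2 ⟨(Complex.continuous_ofReal.tendsto 0).mono_left
        nhdsWithin_le_nhds, ?_⟩
      filter_upwards [self_mem_nhdsWithin] with x hx
      simpa using hx
    exact htend.frequently hreal
  refine Measure.ext_of_charFun (funext fun t => ?_)
  rw [← complexMGF_id_mul_I, ← complexMGF_id_mul_I]
  exact heq (by simpa using hδ)

lemma HasLaplace.mono {c s : ℝ} {f : ℝ → ℝ} (hf : HasLaplace c f) (hcs : c ≤ s) :
    HasLaplace s f := by
  have h : IntegrableOn (fun t : ℝ => Real.exp (-(s - c) * t) * (Real.exp (-c * t) * f t))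
      (Ioi 0) := by
    refine Integrable.bdd_mul (c := 1) hf (by fun_prop) ?_
    filter_upwards [self_mem_ae_restrict measurableSet_Ioi] with t ht
    rw [Real.norm_eq_abs, Real.abs_exp, Real.exp_le_one_iff]
    have : (0 : ℝ) < t := ht
    nlinarith
  refine h.congr (ae_of_all _ fun t => ?_)
  simp only
  rw [← mul_assoc, ← Real.exp_add]
  ring_nf

/-- Lerch's theorem: a function whose Laplace transform vanishes on a real half-line is zero. -/
lemma HasLaplace.ae_eq_zero {c : ℝ} {f : ℝ → ℝ} (hf : HasLaplace c f)
    (h : ∀ s, c < s → ∫ t in Ioi (0 : ℝ), Real.exp (-s * t) * f t = 0) :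
    ∀ᵐ t, 0 < t → f t = 0 := by
  set φ : ℝ → ℝ := fun t => Real.exp (-(c + 1) * t) * f t
  have hφ : IntegrableOn φ (Ioi 0) := hf.mono (by linarith)
  -- The positive and the negative part of `φ` are the densities of the finite measures `μ φ` and
  -- `μ (-φ)`; the weight `e^{-(c+1)t}` makes their moment generating functions finite near `0`.
  set μ : (ℝ → ℝ) → Measure ℝ := fun g =>
    (volume.restrict (Ioi (0 : ℝ))).withDensity fun t => ENNReal.ofReal (g t)
  have hfin : ∀ g : ℝ → ℝ, IntegrableOn g (Ioi 0) → IsFiniteMeasure (μ g) := fun g hg =>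
    isFiniteMeasure_withDensity_ofReal hg.2
  have hexpφ : ∀ t < 1, IntegrableOn (fun x => Real.exp (t * x) * φ x) (Ioi 0) := by
    intro t ht
    refine (hf.mono (s := c + 1 - t) (by linarith)).congr (ae_of_all _ fun x => ?_)
    simp only [φ]
    rw [← mul_assoc, ← Real.exp_add]
    ring_nf
  have hmax : ∀ g : ℝ → ℝ, (∀ t < 1, IntegrableOn (fun x => Real.exp (t * x) * g x) (Ioi 0)) →
      ∀ t < 1, IntegrableOn (fun x => (ENNReal.ofReal (g x)).toReal * Real.exp (t * x)) (Ioi 0) := by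
    intro g hg t ht
    refine Integrable.congr (Integrable.pos_part (hg t ht)) (ae_of_all _ fun x => ?_)
    simp only
    rw [ENNReal.toReal_ofReal', mul_comm, max_mul_of_nonneg _ _ (Real.exp_pos _).le, zero_mul]
  have hmeas : ∀ g : ℝ → ℝ, IntegrableOn g (Ioi 0) →
      AEMeasurable (fun t => ENNReal.ofReal (g t)) (volume.restrict (Ioi (0 : ℝ))) := fun g hg =>
    hg.aemeasurable.ennreal_ofReal
  have hint : ∀ g : ℝ → ℝ, IntegrableOn g (Ioi 0) →
      (∀ t < 1, IntegrableOn (fun x => Real.exp (t * x) * g x) (Ioi 0)) →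
      ∀ t < 1, Integrable (fun x => Real.exp (t * x)) (μ g) := by
    intro g hg hg' t ht
    rw [integrable_withDensity_iff_integrable_smul₀' (hmeas g hg) (by simp)]
    exact hmax g hg' t ht
  have hneg' : ∀ t < 1, IntegrableOn (fun x => Real.exp (t * x) * (-φ) x) (Ioi 0) := by
    intro t ht
    refine (hexpφ t ht).neg.congr (ae_of_all _ fun x => ?_)
    simp
  have := hfin φ hφ
  have := hfin (-φ) hφ.neg
  have hμeq : μ φ = μ (-φ) := by
    refine measure_ext_of_mgf_eq one_pos (hint φ hφ hexpφ) (hint (-φ) hφ.neg hneg') ?_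
    intro t ht
    rw [integral_withDensity_eq_integral_toReal_smul₀ (hmeas φ hφ) (by simp),
      integral_withDensity_eq_integral_toReal_smul₀ (hmeas (-φ) hφ.neg) (by simp), ← sub_eq_zero]
    simp only [smul_eq_mul]
    rw [← integral_sub (hmax φ hexpφ t ht) (hmax (-φ) hneg' t ht)]
    refine Eq.trans (integral_congr_ae (ae_of_all _ fun x => ?_)) (h (c + 1 - t) (by linarith))
    simp only [ENNReal.toReal_ofReal', Pi.neg_apply]
    rw [← sub_mul, max_zero_sub_max_neg_zero_eq_self]
    simp only [φ]
    rw [mul_right_comm, ← Real.exp_add]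
    ring_nf
  have hae := (withDensity_eq_iff (hmeas φ hφ) (hmeas (-φ) hφ.neg)
    hφ.lintegral_lt_top.ne).1 hμeq
  rw [EventuallyEq, ae_restrict_iff' measurableSet_Ioi] at hae
  filter_upwards [hae] with t ht h0
  have h1 := ht h0
  have h2 : φ t = 0 := by
    rcases le_total (φ t) 0 with hle | hle
    · have h3 : ENNReal.ofReal (-φ t) = 0 := by
        rw [← Pi.neg_apply, ← h1, ENNReal.ofReal_of_nonpos hle]
      linarith [ENNReal.ofReal_eq_zero.1 h3]
    · have h3 : ENNReal.ofReal (φ t) = 0 := by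
        rw [h1, Pi.neg_apply, ENNReal.ofReal_of_nonpos (by linarith)]
      linarith [ENNReal.ofReal_eq_zero.1 h3]
  exact (mul_eq_zero.1 h2).resolve_left (Real.exp_pos _).ne'

/-! ### Causal convolution with a probability measure -/

/-- The Laplace transform turns the convolution of `F` with `ρ` into a product. -/
lemma integrable_conv_and_integral_eq {ρ : Measure ℝ} [IsProbabilityMeasure ρ]
    (hρ : ∀ᵐ x ∂ρ, 0 ≤ x) {s : ℝ} (hs : 0 ≤ s) {F : ℝ → ℝ}
    (hF : Integrable fun t => Real.exp (-s * t) * F t) :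
    Integrable (fun t => Real.exp (-s * t) * ∫ x, F (t - x) ∂ρ) ∧
      ∫ t, Real.exp (-s * t) * ∫ x, F (t - x) ∂ρ =
        (∫ x, Real.exp (-s * x) ∂ρ) * ∫ t, Real.exp (-s * t) * F t := by
  have hprod := (integrable_exp_neg_mul hρ hs).mul_prod hF
  have hpres := measurePreserving_prod_sub_swap (volume : Measure ℝ) ρ
  have hshift : ∀ t x : ℝ, Real.exp (-s * x) * (Real.exp (-s * (t - x)) * F (t - x)) =
      Real.exp (-s * t) * F (t - x) := by
    intro t x
    rw [← mul_assoc, ← Real.exp_add]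
    ring_nf
  have hcomp : Integrable (fun p : ℝ × ℝ => Real.exp (-s * p.1) * F (p.1 - p.2))
      ((volume : Measure ℝ).prod ρ) :=
    (hpres.integrable_comp_of_integrable hprod).congr (ae_of_all _ fun p => hshift p.1 p.2)
  refine ⟨?_, ?_⟩
  · have h := hcomp.integral_prod_left
    simpa only [integral_const_mul] using h
  · have h1 := integral_prod _ hcomp
    simp only [integral_const_mul] at h1
    rw [← h1, ← integral_prod_mul, ← hpres.map_eq, integral_map hpres.measurable.aemeasurable
      (by rw [hpres.map_eq]; exact hprod.aestronglyMeasurable)]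
    exact integral_congr_ae (ae_of_all _ fun p => (hshift p.1 p.2).symm)

/-- If `ĝ = κ ρ̂ f̂`, then `g` is `κ` times the causal convolution of `f` with `ρ`, so that bounds
for `f` with respect to an exponential weight pass to `g` on every initial time interval. -/
lemma HasLaplace.ae_bound {ρ : Measure ℝ} [IsProbabilityMeasure ρ]
    (hρ : ∀ᵐ x ∂ρ, 0 ≤ x) {c : ℝ} (hc : 0 ≤ c) {f g : ℝ → ℝ} (hf : HasLaplace c f)
    (hg : HasLaplace c g) {κ : ℝ}
    (hfg : ∀ s, c < s → ∫ t in Ioi (0 : ℝ), Real.exp (-s * t) * g t =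
      κ * (∫ x, Real.exp (-s * x) ∂ρ) * ∫ t in Ioi (0 : ℝ), Real.exp (-s * t) * f t)
    {s₀ T M : ℝ} (hs₀ : 0 ≤ s₀) (hM : 0 ≤ M)
    (hb : ∀ᵐ t, 0 < t → t < T → |f t| ≤ M * Real.exp (s₀ * t)) :
    ∀ᵐ t, 0 < t → t < T →
      |g t| ≤ |κ| * (∫ x, Real.exp (-s₀ * x) ∂ρ) * M * Real.exp (s₀ * t) := by
  have hfm : AEStronglyMeasurable f (volume.restrict (Ioi 0)) := by
    have h : AEStronglyMeasurable (fun t => Real.exp (c * t) * (Real.exp (-c * t) * f t))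
        (volume.restrict (Ioi 0)) :=
      AEStronglyMeasurable.mul (by fun_prop) hf.aestronglyMeasurable
    refine h.congr (ae_of_all _ fun t => ?_)
    simp only
    rw [← mul_assoc, ← Real.exp_add]
    simp
  set f' := hfm.mk f
  have hf'm : Measurable f' := hfm.stronglyMeasurable_mk.measurable
  have hff' : ∀ᵐ t, 0 < t → f t = f' t := (ae_restrict_iff' measurableSet_Ioi).1 hfm.ae_eq_mk
  -- A representative of `f` on `(0, ∞)` for which the bound holds everywhere.
  set S : Set ℝ := {t | 0 < t ∧ (t < T → |f' t| ≤ M * Real.exp (s₀ * t))}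
  have hS : MeasurableSet S := by
    have : S = Ioi 0 ∩ (Ici T ∪ {t | |f' t| ≤ M * Real.exp (s₀ * t)}) := by
      ext t
      simp only [S, mem_ofPred_eq, mem_inter_iff, mem_Ioi, mem_union, mem_Ici, ← not_lt]
      tauto
    rw [this]
    refine measurableSet_Ioi.inter (measurableSet_Ici.union ?_)
    exact measurableSet_le (by fun_prop) (by fun_prop)
  set F : ℝ → ℝ := S.indicator f'
  have hFf : ∀ᵐ t, F t = (Ioi (0 : ℝ)).indicator f t := by
    filter_upwards [hff', hb] with t h1 h2
    by_cases ht : 0 < t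
    · have hmem : t ∈ S := ⟨ht, fun hT => h1 ht ▸ h2 ht hT⟩
      simp only [F]
      rw [indicator_of_mem hmem, indicator_of_mem (mem_Ioi.2 ht), h1 ht]
    · simp only [F]
      rw [indicator_of_notMem fun h : t ∈ S => ht h.1, indicator_of_notMem (by simpa using ht)]
  have hexpF : ∀ s, (fun t => Real.exp (-s * t) * F t) =ᵐ[volume]
      (Ioi (0 : ℝ)).indicator fun t => Real.exp (-s * t) * f t := by
    intro s
    filter_upwards [hFf] with t ht
    rw [ht]
    by_cases h0 : 0 < t <;> simp [h0]
  have hFint : ∀ s, c ≤ s → Integrable fun t => Real.exp (-s * t) * F t := fun s hs =>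
    ((integrable_indicator_iff measurableSet_Ioi).2 (hf.mono hs)).congr (hexpF s).symm
  have hFbound : ∀ t, t < T → |F t| ≤ M * Real.exp (s₀ * t) := by
    intro t ht
    by_cases hmem : t ∈ S
    · simp only [F]
      rw [indicator_of_mem hmem]
      exact hmem.2 ht
    · simp only [F]
      rw [indicator_of_notMem hmem, abs_zero]
      positivity
  set G : ℝ → ℝ := fun t => ∫ x, F (t - x) ∂ρ
  have hG0 : ∀ t ≤ 0, G t = 0 := by
    intro t ht
    refine integral_eq_zero_of_ae ?_
    filter_upwards [hρ] with x hx
    exact indicator_of_notMem (fun h : t - x ∈ S => by linarith [h.1]) _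
  have hGint : ∀ s, c ≤ s → Integrable fun t => Real.exp (-s * t) * G t := fun s hs =>
    (integrable_conv_and_integral_eq hρ (hc.trans hs) (hFint s hs)).1
  have hGL : ∀ s, c < s → ∫ t in Ioi (0 : ℝ), Real.exp (-s * t) * G t =
      (∫ x, Real.exp (-s * x) ∂ρ) * ∫ t in Ioi (0 : ℝ), Real.exp (-s * t) * f t := by
    intro s hs
    rw [setIntegral_eq_integral_of_forall_compl_eq_zero fun t ht => by
        rw [hG0 t (by simpa using ht), mul_zero],
      (integrable_conv_and_integral_eq hρ (hc.trans hs.le) (hFint s hs.le)).2,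
      integral_congr_ae (hexpF s), integral_indicator measurableSet_Ioi]
  have hw : ∀ s, c ≤ s → HasLaplace s fun t => g t - κ * G t := by
    intro s hs
    refine ((hg.mono hs).sub ((hGint s hs).integrableOn.const_mul κ)).congr
      (ae_of_all _ fun t => ?_)
    simp only [Pi.sub_apply]
    ring
  have hgG : ∀ᵐ t, 0 < t → g t - κ * G t = 0 := by
    refine (hw c le_rfl).ae_eq_zero fun s hs => ?_
    have e : ∀ t, Real.exp (-s * t) * (g t - κ * G t) =
        Real.exp (-s * t) * g t - κ * (Real.exp (-s * t) * G t) := fun t => by ring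
    simp only [e]
    rw [integral_sub (hg.mono hs.le) ((hGint s hs.le).integrableOn.const_mul κ),
      integral_const_mul, hGL s hs, hfg s hs]
    ring
  filter_upwards [hgG] with t ht h0 hT
  rw [sub_eq_zero.1 (ht h0), abs_mul, mul_assoc, mul_assoc]
  refine mul_le_mul_of_nonneg_left ?_ (abs_nonneg κ)
  have hi : Integrable (fun x => Real.exp (-s₀ * x) * (M * Real.exp (s₀ * t))) ρ :=
    (integrable_exp_neg_mul hρ hs₀).mul_const _
  calc |G t| ≤ ∫ x, Real.exp (-s₀ * x) * (M * Real.exp (s₀ * t)) ∂ρ := by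
        refine (Real.norm_eq_abs _).symm.trans_le (norm_integral_le_of_norm_le hi ?_)
        filter_upwards [hρ] with x hx
        refine (hFbound (t - x) (by linarith)).trans_eq ?_
        rw [mul_left_comm, ← Real.exp_add]
        ring_nf
    _ = _ := integral_mul_const _ _

/-! ### Bounds for the iteration -/

lemma symbol_nonneg {a b z : ℝ} (ha : 0 < a) (hab : a < b) (hz : 0 < z) : 0 ≤ symbol a b z := by
  have h1 : 0 < Real.sinh (z * (b - a)) := Real.sinh_pos_iff.2 (mul_pos hz (sub_pos.2 hab))
  have h2 : 0 < Real.sinh (z * a) := Real.sinh_pos_iff.2 (mul_pos hz ha)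
  have h3 := Real.cosh_pos (z * b)
  rw [symbol]
  positivity

lemma symbol_le {a b z : ℝ} (ha : 0 < a) (hz : 0 < z) :
    symbol a b z ≤ Real.exp (-(2 * (z * a))) / (1 - Real.exp (-(2 * (z * a)))) := by
  have h2 : 0 < Real.sinh (z * a) := Real.sinh_pos_iff.2 (mul_pos hz ha)
  have h3 := Real.cosh_pos (z * b)
  have h4 : 0 < 1 - Real.exp (-(2 * (z * a))) := by
    rw [sub_pos, Real.exp_lt_one_iff]
    have := mul_pos hz ha
    linarith
  have h5 : 2 * Real.sinh (z * a) = Real.exp (z * a) * (1 - Real.exp (-(2 * (z * a)))) := by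
    rw [Real.sinh_eq, mul_sub, ← Real.exp_add]
    ring_nf
  have h6 : Real.sinh (z * (b - a)) ≤ Real.exp (-(z * a)) * Real.cosh (z * b) := by
    rw [Real.sinh_eq, Real.cosh_eq, ← mul_div_assoc, mul_add, ← Real.exp_add, ← Real.exp_add]
    have e : z * (b - a) = -(z * a) + z * b := by ring
    rw [← e]
    linarith [Real.exp_pos (-(z * (b - a))), Real.exp_pos (-(z * a) + -(z * b))]
  rw [symbol, div_le_div_iff₀ (by positivity) h4, h5]
  calc _ ≤ Real.exp (-(z * a)) * Real.cosh (z * b) * (1 - Real.exp (-(2 * (z * a)))) :=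
        mul_le_mul_of_nonneg_right h6 h4.le
    _ = _ := by
        have e : Real.exp (-(z * a)) = Real.exp (-(2 * (z * a))) * Real.exp (z * a) := by
          rw [← Real.exp_add]
          ring_nf
        rw [e]
        ring

/-- The bound with weight `e^{s₀t}` after `k` sweeps. It holds on each initial interval `(0, T)`
separately, because the kernel of a sweep is causal. -/
lemma IsIteration.ae_bound {a b σ : ℝ} (ha : 0 < a) (hab : a < b) {h : ℕ → ℝ → ℝ}
    {u₁ u₂ : ℕ → ℝ → ℝ → ℝ} (hiter : IsIteration a b (1 / 2) σ h u₁ u₂)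
    {ρ : Measure ℝ} [IsProbabilityMeasure ρ] (hρ : ∀ᵐ x ∂ρ, 0 ≤ x)
    (hL : ∀ z, 0 < z → (b - a) / (2 * a) * ∫ x, Real.exp (-z ^ 2 * x) ∂ρ = symbol a b z)
    {s₀ T M : ℝ} (hs₀ : 0 ≤ s₀) (hM : 0 ≤ M)
    (hb : ∀ᵐ t, 0 < t → t < T → |h 0 t| ≤ M * Real.exp (s₀ * t)) (k : ℕ) :
    ∀ᵐ t, 0 < t → t < T → |h k t| ≤
      ((b - a) / (2 * a) * ∫ x, Real.exp (-s₀ * x) ∂ρ) ^ k * M * Real.exp (s₀ * t) := by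
  have hκ : 0 < (b - a) / (2 * a) := div_pos (sub_pos.2 hab) (by positivity)
  have hI : 0 ≤ ∫ x, Real.exp (-s₀ * x) ∂ρ := integral_nonneg fun x => (Real.exp_pos _).le
  induction k with
  | zero => simpa using hb
  | succ k ih =>
    have hstep := HasLaplace.ae_bound hρ (le_max_right σ 0)
      ((hiter.laplace_h k).mono (le_max_left σ 0)) ((hiter.laplace_h (k + 1)).mono (le_max_left σ 0))
      (κ := -((b - a) / (2 * a))) (fun s hs => ?_) hs₀ (by positivity) ih
    · filter_upwards [hstep] with t ht h0 hT
      refine (ht h0 hT).trans_eq ?_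
      rw [abs_neg, abs_of_pos hκ]
      ring
    · have hs0 : 0 < s := (le_max_right σ 0).trans_lt hs
      have hz : 0 < Real.sqrt s := Real.sqrt_pos.2 hs0
      have hsq := Real.sq_sqrt hs0.le
      have h1 := hiter.laplace_succ ha (ha.trans hab) k hz
        (hsq.symm ▸ (le_max_left σ 0).trans_lt hs)
      rw [← hL _ hz, hsq] at h1
      rw [h1]
      ring

lemma eLpNorm_top_le_of_forall_ae_bound {I : Set ℝ} (hI : MeasurableSet I) {f g : ℝ → ℝ} {C : ℝ}
    (hC : 0 < C) (H : ∀ M, 0 ≤ M → (∀ᵐ t, t ∈ I → |f t| ≤ M) → ∀ᵐ t, t ∈ I → |g t| ≤ C * M) :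
    eLpNorm g ∞ (volume.restrict I) ≤ ENNReal.ofReal C * eLpNorm f ∞ (volume.restrict I) := by
  simp only [eLpNorm_exponent_top]
  rcases eq_or_ne (eLpNormEssSup f (volume.restrict I)) ∞ with htop | htop
  · rw [htop, ENNReal.mul_top (by simpa using hC)]
    exact le_top
  · have hf : ∀ᵐ t, t ∈ I → |f t| ≤ (eLpNormEssSup f (volume.restrict I)).toReal := by
      rw [← ae_restrict_iff' hI]
      filter_upwards [enorm_ae_le_eLpNormEssSup f (volume.restrict I)] with t ht
      rw [← Real.norm_eq_abs, ← toReal_enorm]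
      exact ENNReal.toReal_mono htop ht
    have hg := H _ ENNReal.toReal_nonneg hf
    rw [← ae_restrict_iff' hI] at hg
    refine (eLpNormEssSup_le_of_ae_bound hg).trans_eq ?_
    rw [ENNReal.ofReal_mul hC.le, ENNReal.ofReal_toReal htop]

/-- The Chernoff bound with the weight `e^{z²t}`, `z = (k + 1/2) a / T`. -/
lemma symbol_pow_mul_exp_le {a b T : ℝ} (ha : 0 < a) (hab : a < b) (hT : 0 < T) {k : ℕ}
    (hk : 1 ≤ k) :
    symbol a b ((k + 1 / 2) * a / T) ^ (2 * k) * Real.exp (((k + 1 / 2) * a / T) ^ 2 * T) ≤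
      (Real.sqrt 2 / (1 - Real.exp (-((2 * (k : ℝ) + 1) * a ^ 2 / T)))) ^ (2 * k) *
        Real.exp (-((k : ℝ) ^ 2 * a ^ 2 / T)) := by
  set z : ℝ := (k + 1 / 2) * a / T
  have hz : 0 < z := by positivity
  have hle := symbol_le (b := b) ha hz
  have hy : 2 * (z * a) = (2 * (k : ℝ) + 1) * a ^ 2 / T := by
    simp only [z]; field_simp
  rw [hy] at hle
  set y : ℝ := (2 * (k : ℝ) + 1) * a ^ 2 / T
  have hy0 : 0 < y := by positivity
  have hd : 0 < 1 - Real.exp (-y) := by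
    rw [sub_pos, Real.exp_lt_one_iff]; linarith
  have hk' : (1 : ℝ) ≤ k := by exact_mod_cast hk
  have hexp : Real.exp (-y) ^ (2 * k) * Real.exp (z ^ 2 * T) ≤
      Real.exp (-((k : ℝ) ^ 2 * a ^ 2 / T)) := by
    rw [← Real.exp_nat_mul, ← Real.exp_add, Real.exp_le_exp, ← sub_nonneg]
    have e : -((k : ℝ) ^ 2 * a ^ 2 / T) - (((2 * k : ℕ) : ℝ) * -y + z ^ 2 * T) =
        (2 * (k : ℝ) ^ 2 + k - 1 / 4) * (a ^ 2 / T) := by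
      simp only [y, z]
      push_cast
      field_simp
      ring
    rw [e]
    exact mul_nonneg (by nlinarith) (by positivity)
  have hsqrt : 1 ≤ Real.sqrt 2 ^ (2 * k) :=
    one_le_pow₀ (Real.one_le_sqrt.2 (by norm_num))
  calc symbol a b z ^ (2 * k) * Real.exp (z ^ 2 * T)
      ≤ (Real.exp (-y) / (1 - Real.exp (-y))) ^ (2 * k) * Real.exp (z ^ 2 * T) := by
        gcongr
        exact symbol_nonneg ha hab hz
    _ = (Real.exp (-y) ^ (2 * k) * Real.exp (z ^ 2 * T)) / (1 - Real.exp (-y)) ^ (2 * k) := by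
        rw [div_pow]; ring
    _ ≤ (Real.sqrt 2 ^ (2 * k) * Real.exp (-((k : ℝ) ^ 2 * a ^ 2 / T))) /
          (1 - Real.exp (-y)) ^ (2 * k) := by
        refine div_le_div_of_nonneg_right ?_ (by positivity)
        exact hexp.trans (le_mul_of_one_le_left (Real.exp_pos _).le hsqrt)
    _ = _ := by rw [div_pow]; ring

end DNWR

theorem theorem3 (a b : ℝ) (ha : 0 < a) (hab : a < b) (σ : ℝ)
    (h : ℕ → ℝ → ℝ) (u₁ u₂ : ℕ → ℝ → ℝ → ℝ)
    (hiter : DNWR.IsIteration a b (1 / 2) σ h u₁ u₂) :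
    (∀ k : ℕ,
      eLpNorm (h (2 * k)) ∞ (volume.restrict (Ioi (0 : ℝ))) ≤
        ENNReal.ofReal (((b - a) / (2 * a)) ^ (2 * k)) *
          eLpNorm (h 0) ∞ (volume.restrict (Ioi (0 : ℝ)))) ∧
    (∀ T : ℝ, 0 < T → ∀ k : ℕ,
      eLpNorm (h (2 * k)) ∞ (volume.restrict (Ioo (0 : ℝ) T)) ≤
        ENNReal.ofReal
            ((Real.sqrt 2 / (1 - Real.exp (-((2 * (k : ℝ) + 1) * a ^ 2 / T)))) ^ (2 * k) *
              Real.exp (-((k : ℝ) ^ 2 * a ^ 2 / T))) *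
          eLpNorm (h 0) ∞ (volume.restrict (Ioo (0 : ℝ) T))) := by
  obtain ⟨ρ, hprob, hρ, hL⟩ := DNWR.exists_measure_symbol ha hab
  have hκ : 0 < (b - a) / (2 * a) := div_pos (sub_pos.2 hab) (by positivity)
  refine ⟨fun k => ?_, fun T hT k => ?_⟩
  · refine DNWR.eLpNorm_top_le_of_forall_ae_bound measurableSet_Ioi (by positivity)
      fun M hM hf => ?_
    -- The intervals `(0, n)` exhaust `(0, ∞)`.
    have hn : ∀ n : ℕ, ∀ᵐ t, 0 < t → t < (n : ℝ) →
        |h (2 * k) t| ≤ ((b - a) / (2 * a)) ^ (2 * k) * M := by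
      intro n
      have := hiter.ae_bound ha hab hρ hL le_rfl hM (T := n)
        (by filter_upwards [hf] with t ht h0 _; simpa using ht h0) (2 * k)
      simpa using this
    filter_upwards [ae_all_iff.2 hn] with t ht h0
    obtain ⟨n, hn⟩ := exists_nat_gt t
    exact ht n h0 hn
  · -- For `k = 0` the factor is `1`; the weight with `z = a / (2T)` would lose `e^{a²/(4T)}`.
    rcases Nat.eq_zero_or_pos k with rfl | hk
    · simp
    have hk' : (1 : ℝ) ≤ k := by exact_mod_cast hk
    have hd : 0 < 1 - Real.exp (-((2 * (k : ℝ) + 1) * a ^ 2 / T)) := by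
      rw [sub_pos, Real.exp_lt_one_iff, neg_lt_zero]
      positivity
    refine DNWR.eLpNorm_top_le_of_forall_ae_bound measurableSet_Ioo (by positivity)
      fun M hM hf => ?_
    have hz : 0 < ((k : ℝ) + 1 / 2) * a / T := by positivity
    have hb := hiter.ae_bound ha hab hρ hL (sq_nonneg (((k : ℝ) + 1 / 2) * a / T)) hM (T := T)
      (by
        filter_upwards [hf] with t ht h0 hT
        refine (ht ⟨h0, hT⟩).trans (le_mul_of_one_le_right hM (Real.one_le_exp (by positivity))))
      (2 * k)
    rw [hL _ hz] at hb
    filter_upwards [hb] with t ht hmem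
    refine (ht hmem.1 hmem.2).trans ?_
    calc _ ≤ DNWR.symbol a b ((k + 1 / 2) * a / T) ^ (2 * k) * M *
          Real.exp (((k + 1 / 2) * a / T) ^ 2 * T) := by
          have := DNWR.symbol_nonneg ha hab hz
          have := hmem.2
          gcongr
      _ = DNWR.symbol a b ((k + 1 / 2) * a / T) ^ (2 * k) *
          Real.exp (((k + 1 / 2) * a / T) ^ 2 * T) * M := by ring
      _ ≤ _ := mul_le_mul_of_nonneg_right (DNWR.symbol_pow_mul_exp_le ha hab hT hk) hM
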